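/- Let $k$ be a field of characteristic $p>0$ and let $G$ be a finite group of order $p^n$. Let $\mathfrak{Ts}$ be the category whose objects are the finitely generated commutative $k$-algebras $A$ on which $G$ acts by $k$-algebra automorphisms and which are trace-surjective, i.e. $\{\sum_{g\in G} g a : a\in A\}=A^G$; its morphisms are the $G$-equivariant $k$-algebra homomorphisms. For $A,B\in\mathfrak{Ts}$ write $A\prec B$ if there is a monomorphism $A\to B$ in $\mathfrak{Ts}$, and $A\approx B$ if $A\prec B$ and $B\prec A$. An object $B$ is \emph{universal} if for every $C\in\mathfrak{Ts}$ there is a morphism $B\to C$; it is \emph{minimal} if $A\prec B$ implies $B\prec A$ for all $A\in\mathfrak{Ts}$; it is \emph{basic} if it is universal and minimal. A proper quotient of $A$ is a quotient $A/I$ by a nonzero $G$-stable ideal $I$, and such a quotient is called a subalgebra of $A$ if there is an injective morphism $A/I\to A$ in $\mathfrak{Ts}$. Let $A\in\mathfrak{Ts}$ be universal. Then the following are equivalent: \begin{enumerate} \item $A$ is basic; \item $A$ is basic and an integral domain; \item every endomorphism of $A$ in $\mathfrak{Ts}$ is injective; \item $A\prec B$ for every universal $B\in\mathfrak{Ts}$;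 \item $A\approx B$ for some basic object $B\in\mathfrak{Ts}$ (equivalently, $A\approx B$ for every basic object $B\in\mathfrak{Ts}$); \item no proper quotient of $A$ is universal; \item no proper quotient of $A$ is a subalgebra of $A$. \end{enumerate} Moreover, basic objects exist and form exactly one $\approx$-equivalence class in $\mathfrak{Ts}$. All basic objects are integral domains of the same finite Krull dimension $d_k(G)$, with $d_k(G)\le n=\log_p|G|$, and $d_k(G)>0$ if $G\neq 1$. -/

import Mathlib

open CategoryTheory

universe u v

/-- The transfer (trace) map `a ↦ ∑ g, g • a` of a finite group acting on a ring. -/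
def transferMap (G : Type v) [Group G] [Fintype G] (A : Type u) [CommRing A]
    [MulSemiringAction G A] (a : A) : A :=
  ∑ g : G, g • a

/-- An object of the category of trace-surjective algebras: a finitely generated commutative
`k`-algebra `A` on which `G` acts by `k`-algebra automorphisms, such that the image of the transfer
map is the whole ring of invariants. -/
structure TsAlg (k : Type u) [Field k] (G : Type v) [Group G] [Fintype G] where
  carrier : Type u
  [commRing : CommRing carrier]
  [algebra : Algebra k carrier]
  [action : MulSemiringAction G carrier]
  [smulComm : SMulCommClass G k carrier]
  finiteType : Algebra.FiniteType k carrier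
  traceSurjective : Set.range (transferMap G carrier) = MulAction.fixedPoints G carrier

namespace TsAlg

variable {k : Type u} [Field k] {G : Type v} [Group G] [Fintype G]

instance : CoeSort (TsAlg k G) (Type u) := ⟨TsAlg.carrier⟩

attribute [instance] TsAlg.commRing TsAlg.algebra TsAlg.action TsAlg.smulComm

/-- Morphisms are the `G`-equivariant homomorphisms of `k`-algebras. -/
@[ext]
structure Hom (A B : TsAlg k G) where
  toAlgHom : A →ₐ[k] B
  map_smul' : ∀ (g : G) (a : A), toAlgHom (g • a) = g • toAlgHom a

instance : Category (TsAlg k G) where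
  Hom A B := Hom A B
  id A := ⟨AlgHom.id k A, fun _ _ => rfl⟩
  comp f g := ⟨g.toAlgHom.comp f.toAlgHom, fun x a => by
    simp [f.map_smul', g.map_smul']⟩

/-- The underlying map of a morphism. -/
def Hom.fn {A B : TsAlg k G} (f : A ⟶ B) : A → B := fun a => Hom.toAlgHom f a

/-- `A` is universal: a weakly initial object of the category. -/
def IsUniversal (A : TsAlg k G) : Prop := ∀ B : TsAlg k G, Nonempty (A ⟶ B)

/-- `A ≺ B`: there is a (categorical) monomorphism from `A` to `B`. -/
def Prec (A B : TsAlg k G) : Prop := ∃ f : A ⟶ B, Mono f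

/-- `A ≈ B`: both `A ≺ B` and `B ≺ A`. -/
def Equivalent (A B : TsAlg k G) : Prop := Prec A B ∧ Prec B A

/-- `B` is minimal: `A ≺ B` implies `B ≺ A`. -/
def IsMinimal (B : TsAlg k G) : Prop := ∀ A : TsAlg k G, Prec A B → Prec B A

/-- `B` is basic: universal and minimal. -/
def IsBasic (B : TsAlg k G) : Prop := IsUniversal B ∧ IsMinimal B

/-- `Q` is a proper quotient of `A`: it is (isomorphic to) `A / I` for a nonzero `G`-stable ideal
`I`, i.e. the target of a surjective morphism from `A` with nonzero kernel. -/
def IsProperQuotient (Q A : TsAlg k G) : Prop :=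
  ∃ π : A ⟶ Q, Function.Surjective (Hom.fn π) ∧ RingHom.ker (Hom.toAlgHom π) ≠ ⊥

/-- `S` is (isomorphic to) a `G`-stable subalgebra of `A`. -/
def IsSubalgebraOf (S A : TsAlg k G) : Prop :=
  ∃ ι : S ⟶ A, Function.Injective (Hom.fn ι)

end TsAlg

/-! A trace-one element `c` makes degree-one cohomology vanish, since averaging weighted by the
translates of `c` replaces division by the order of `G`. This yields a universal domain of dimension
at most `n` by induction: for central `Z` of order `p` and a universal `A` for `G ⧸ Z`, let `G` act
on `A[X]` by `X ↦ X + f g`, where the crossed homomorphism `f` identifies `Z` with the prime field.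
A map out of `A[X]` exists because the image of `f` in any target is principal
(`exists_weaklyInitial_domain`).

Anything mapping to a universal object is universal, so the image of an endomorphism of a universal
object is again universal. Take a universal domain `B₀` of least dimension: images of its
endomorphisms cannot have smaller dimension, and a surjection of a finitely generated domain that
preserves dimension is injective. Hence all endomorphisms of `B₀` are injective, and `B₀` embeds in
every universal object. A basic object and `B₀` therefore embed in each other, which transfers the
domain property, the dimension and the injectivity of endomorphisms
(`IsBasic.endomorphism_injective`). The equivalences follow by factoring endomorphisms through their
images. -/

/-! ### Crossed homomorphisms and power sums -/

section Cohomology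

variable {k : Type u} [Field k] {G : Type v} [Group G] [Fintype G]
  {C : Type*} [CommRing C] [Algebra k C]

/-- A crossed homomorphism into an algebra with an element of trace one is principal. -/
theorem exists_principal_of_crossedHom (σ : G →* (C →ₐ[k] C)) {c : C} (hc : ∑ g, σ g c = 1)
    (f : G → C) (hf : ∀ g h, f (g * h) = f g + σ g (f h)) :
    ∃ t : C, ∀ g, σ g t = t + f g := by
  -- The negative average of `f`, with weights `σ h c` that sum to one.
  refine ⟨-∑ h, f h * σ h c, fun g => ?_⟩
  have h1 : ∑ h, f h * σ h c = ∑ h, f (g * h) * σ (g * h) c :=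
    (Fintype.sum_equiv (Equiv.mulLeft g) _ _ fun h => rfl).symm
  have h2 : ∑ h, f g * σ (g * h) c = f g := by
    rw [← Finset.mul_sum, Fintype.sum_equiv (Equiv.mulLeft g) (fun h => σ (g * h) c)
      (fun h => σ h c) fun h => rfl, hc, mul_one]
  have h3 : σ g (∑ h, f h * σ h c) = ∑ h, σ g (f h) * σ (g * h) c := by
    simp [map_sum, map_mul]
  rw [map_neg, h3, h1]
  have h4 : ∑ h, f (g * h) * σ (g * h) c = f g + ∑ h, σ g (f h) * σ (g * h) c := by
    conv_rhs => rw [← h2]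
    rw [← Finset.sum_add_distrib]
    exact Finset.sum_congr rfl fun h _ => by rw [hf, add_mul]
  rw [h4]; ring

/-- In the binomial expansion, power sums over the prime field vanish for exponents below `p - 1`;
only the term free of `y` survives. -/
theorem sum_add_zmod_pow (p : ℕ) [Fact p.Prime] {B : Type*} [CommRing B] (j : ZMod p →+* B)
    (y : B) : ∑ x : ZMod p, (y + j x) ^ (p - 1) = -1 := by
  have hp : 0 < p - 1 := Nat.sub_pos_of_lt (Fact.out : p.Prime).one_lt
  simp_rw [add_pow]
  rw [Finset.sum_comm, Finset.sum_eq_single 0]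
  · have : ∑ x : ZMod p, x ^ (p - 1) = -1 := by
      rw [← Finset.sum_erase_add _ _ (Finset.mem_univ (0 : ZMod p)), zero_pow hp.ne', add_zero,
        Finset.sum_congr rfl (g := fun _ => 1) fun x hx =>
          ZMod.pow_card_sub_one_eq_one (Finset.ne_of_mem_erase hx)]
      simp [Finset.card_erase_of_mem, ZMod.card, Nat.cast_sub (Fact.out : p.Prime).one_le]
    simp only [pow_zero, one_mul, Nat.choose_zero_right, Nat.cast_one, mul_one, tsub_zero]
    rw [← map_one j, ← map_neg, ← this, map_sum]
    simp
  · intro i hi h0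
    have hi' := Finset.mem_range.1 hi
    have : ∑ x : ZMod p, x ^ (p - 1 - i) = 0 :=
      FiniteField.sum_pow_lt_card_sub_one _ _ (by rw [ZMod.card]; omega)
    rw [← Finset.sum_mul]
    simp_rw [← map_pow]
    rw [← Finset.mul_sum, ← map_sum, this]
    simp
  · simp

end Cohomology

/-! ### Passing to a quotient group -/

section FixedSubalgebra

variable {k : Type u} [Field k] {G : Type v} [Group G] {C : Type*} [CommRing C] [Algebra k C]

/-- The subalgebra fixed by a subgroup `N`. -/
def fixedSubalgebra (σ : G →* (C →ₐ[k] C)) (N : Subgroup G) : Subalgebra k C :=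
  ⨅ z : N, AlgHom.equalizer (σ z) (AlgHom.id k C)

theorem mem_fixedSubalgebra (σ : G →* (C →ₐ[k] C)) (N : Subgroup G) (x : C) :
    x ∈ fixedSubalgebra σ N ↔ ∀ z ∈ N, σ z x = x := by
  simp [fixedSubalgebra, Algebra.mem_iInf, AlgHom.mem_equalizer]

/-- The action of `G ⧸ N` on the subalgebra fixed by a normal subgroup `N`. -/
def quotientAction (σ : G →* (C →ₐ[k] C)) (N : Subgroup G) [hN : N.Normal] :
    G ⧸ N →* (fixedSubalgebra σ N →ₐ[k] fixedSubalgebra σ N) :=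
  QuotientGroup.lift N
    { toFun g := ((σ g).comp (fixedSubalgebra σ N).val).codRestrict _ fun x => by
        rw [mem_fixedSubalgebra]
        intro z hz
        have h : z * g = g * (g⁻¹ * z * g) := by group
        have h' : g⁻¹ * z * g ∈ N := by simpa using hN.conj_mem z hz g⁻¹
        change σ z (σ g x) = σ g x
        rw [← AlgHom.mul_apply, ← map_mul, h, map_mul, AlgHom.mul_apply,
          (mem_fixedSubalgebra σ N x).1 x.2 _ h']
      map_one' := by ext x; simp
      map_mul' g h := by ext x; simp }
    fun z hz => by
      ext x
      exact (mem_fixedSubalgebra σ N x).1 x.2 z hz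

theorem coe_quotientAction (σ : G →* (C →ₐ[k] C)) (N : Subgroup G) [N.Normal] (g : G)
    (x : fixedSubalgebra σ N) : (quotientAction σ N (g : G ⧸ N) x : C) = σ g x := rfl

theorem sum_eq_sum_quotient [Fintype G] {M : Type*} [AddCommMonoid M] (N : Subgroup G)
    [Fintype N] [Fintype (G ⧸ N)] (F : G → M) :
    ∑ g, F g = ∑ w : G ⧸ N, ∑ z : N, F (w.out * z) := by
  rw [← Fintype.sum_prod_type']
  have hmk (w : G ⧸ N) (z : N) : ((w.out * z : G) : G ⧸ N) = w := by
    rw [QuotientGroup.mk_mul_of_mem _ z.2, QuotientGroup.out_eq']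
  refine (Fintype.sum_bijective (fun wz : (G ⧸ N) × N => wz.1.out * (wz.2 : G))
    ⟨?_, fun g => ?_⟩ _ _ fun _ => rfl).symm
  · rintro ⟨w, z⟩ ⟨w', z'⟩ h
    have hw : w = w' := by rw [← hmk w z, ← hmk w' z']; exact congrArg _ h
    subst hw
    simpa using h
  · refine ⟨⟨g, (Quotient.out (g : G ⧸ N))⁻¹ * g, ?_⟩, by simp⟩
    exact QuotientGroup.eq.1 (QuotientGroup.out_eq' _)

/-- Transitivity of the trace: the `N`-trace of `c` is `N`-fixed, and its trace over `G ⧸ N` is the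
full trace of `c`. -/
theorem exists_trace_one_fixedSubalgebra [Fintype G] (σ : G →* (C →ₐ[k] C)) (N : Subgroup G)
    [N.Normal] [Fintype (G ⧸ N)] (h : ∃ c, ∑ g, σ g c = 1) :
    ∃ c, ∑ w, quotientAction σ N w c = 1 := by
  classical
  obtain ⟨c, hc⟩ := h
  have hmem : ∑ z : N, σ z c ∈ fixedSubalgebra σ N := by
    rw [mem_fixedSubalgebra]
    intro z hz
    rw [map_sum]
    exact Fintype.sum_equiv (Equiv.mulLeft (⟨z, hz⟩ : N)) _ _ fun y => by simp
  refine ⟨⟨_, hmem⟩, Subtype.ext ?_⟩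
  rw [sum_eq_sum_quotient N] at hc
  rw [AddSubmonoidClass.coe_finsetSum, OneMemClass.coe_one, ← hc]
  refine Finset.sum_congr rfl fun w _ => ?_
  conv_lhs => rw [← QuotientGroup.out_eq' w]
  rw [coe_quotientAction]
  simp

end FixedSubalgebra

/-! ### Central subgroups of order `p` -/

section CentralStep

variable {G : Type v} [Group G] (p : ℕ) [Fact p.Prime]

theorem exists_central_subgroup_card_prime [Finite G] {n : ℕ} (hG : Nat.card G = p ^ (n + 1)) :
    ∃ Z : Subgroup G, Z ≤ Subgroup.center G ∧ Nat.card Z = p := by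
  have hpG : IsPGroup p G := IsPGroup.of_card hG
  have : Nontrivial G := by
    rw [← Finite.one_lt_card_iff_nontrivial, hG]
    exact Nat.one_lt_pow (Nat.succ_ne_zero n) (Fact.out : p.Prime).one_lt
  have hc := hpG.center_nontrivial
  have hdvd : p ∣ Nat.card (Subgroup.center G) := by
    obtain ⟨m, hm⟩ := IsPGroup.iff_card.1 (hpG.to_subgroup (Subgroup.center G))
    have h1 := Finite.one_lt_card_iff_nontrivial.2 hc
    rw [hm] at h1 ⊢
    refine dvd_pow_self p ?_
    rintro rfl
    simp at h1
  obtain ⟨z, hz⟩ := exists_prime_orderOf_dvd_card' p hdvd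
  refine ⟨Subgroup.zpowers (z : G), by simp, ?_⟩
  rw [Nat.card_zpowers, Subgroup.orderOf_coe, hz]

/-- A central subgroup `Z` of order `p` is coordinatized by a `Z`-equivariant map `G → ZMod p`. -/
theorem exists_equivariant_zmod (Z : Subgroup G) (hZ : Nat.card Z = p) :
    ∃ (e : Z ≃ ZMod p) (φ : G → ZMod p), ∀ (z : Z) g, φ (z * g) = e z + φ g := by
  have : IsCyclic Z := isCyclic_of_prime_card hZ
  obtain ⟨e⟩ : Nonempty (Z ≃* Multiplicative (ZMod p)) :=
    ⟨mulEquivOfCyclicCardEq (by rw [hZ]; simp)⟩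
  -- A representative of the coset `Z g`; `φ` reads off the `Z`-component of `g` relative to it.
  let s : G → G := fun g => Quotient.out (Quotient.mk (QuotientGroup.rightRel Z) g)
  have hmem (g : G) : g * (s g)⁻¹ ∈ Z :=
    QuotientGroup.rightRel_apply.1
      (Quotient.exact (Quotient.out_eq (Quotient.mk (QuotientGroup.rightRel Z) g)))
  have hs (z : Z) (g : G) : s (z * g) = s g :=
    congrArg Quotient.out (Quotient.sound (QuotientGroup.rightRel_apply.2 (by simp)))
  refine ⟨e.toEquiv.trans Multiplicative.toAdd, fun g => (e ⟨_, hmem g⟩).toAdd, fun z g => ?_⟩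
  have h : (⟨_, hmem (z * g)⟩ : Z) = z * ⟨_, hmem g⟩ := Subtype.ext (by simp [hs, mul_assoc])
  change (e ⟨_, hmem (z * g)⟩).toAdd = _
  rw [h, map_mul, toAdd_mul]
  rfl

end CentralStep

/-! ### Adjoining a variable with translation action -/

section Extension

open Polynomial

variable {k : Type u} [Field k] {G : Type v} [Group G] {A : Type*} [CommRing A] [Algebra k A]

/-- The action of `G` on `A[X]` with `g • X = X + f g`, for a crossed homomorphism `f`. -/
noncomputable def translationAction (ρ : G →* (A →ₐ[k] A)) (f : G → A)
    (hf : ∀ g h, f (g * h) = f g + ρ g (f h)) : G →* (A[X] →ₐ[k] A[X]) where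
  toFun g := eval₂AlgHom (CAlgHom.comp (ρ g)) (X + C (f g)) fun _ => Commute.all _ _
  map_one' := by
    have h1 : f 1 = 0 := by simpa using hf 1 1
    refine algHom_ext' ?_ ?_
    · ext a; simp
    · simp [h1]
  map_mul' g h := by
    refine algHom_ext' ?_ ?_
    · ext a; simp
    · simp [hf, add_assoc]

@[simp]
theorem translationAction_X (ρ : G →* (A →ₐ[k] A)) (f : G → A)
    (hf : ∀ g h, f (g * h) = f g + ρ g (f h)) (g : G) :
    translationAction ρ f hf g X = X + C (f g) := by
  simp [translationAction]

@[simp]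
theorem translationAction_C (ρ : G →* (A →ₐ[k] A)) (f : G → A)
    (hf : ∀ g h, f (g * h) = f g + ρ g (f h)) (g : G) (a : A) :
    translationAction ρ f hf g (C a) = C (ρ g a) := by
  simp [translationAction]

/-- If a subgroup `Z` of prime order is central, any trace-one `G ⧸ Z`-algebra carries a crossed
homomorphism of `G` that restricts to an isomorphism of `Z` onto the prime field. -/
theorem exists_crossedHom_extending (p : ℕ) [Fact p.Prime] [Fintype G] (j : ZMod p →+* k)
    (Z : Subgroup G) [Z.Normal] [Fintype (G ⧸ Z)]
    (hZ : Z ≤ Subgroup.center G) (hcard : Nat.card Z = p)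
    (ρ : G ⧸ Z →* (A →ₐ[k] A)) {a : A} (ha : ∑ w, ρ w a = 1) :
    ∃ (e : Z ≃ ZMod p) (f : G → A), (∀ g h : G, f (g * h) = f g + ρ.comp (QuotientGroup.mk' Z) g (f h)) ∧
      ∀ (g : G) (z : Z), f (g * z) = f g + algebraMap k A (j (e z)) := by
  obtain ⟨e, φ, hφ⟩ := exists_equivariant_zmod p Z hcard
  -- The increment of `φ` under left multiplication by `g`. It is constant on cosets because `Z` is
  -- central, so choosing `w.out` is harmless.
  let D : G → G ⧸ Z → ZMod p := fun g w => φ (g * w.out) - φ w.out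
  have hcomm (z : Z) (g : G) : g * z = z * g := Subgroup.mem_center_iff.1 (hZ z.2) g
  have hD (g h : G) : D g h = φ (g * h) - φ h := by
    obtain ⟨z, hz⟩ := QuotientGroup.mk_out_eq_mul Z h
    simp only [D]
    rw [hz, ← mul_assoc, hcomm, hcomm, hφ, hφ]
    ring
  let J : ZMod p →+* A := (algebraMap k A).comp j
  have hρJ (w : G ⧸ Z) (x : ZMod p) : ρ w (J x) = J x := AlgHom.commutes _ _
  -- The increments telescope in `g`; averaging them against the translates of `a` gives a cocycle
  -- with values in `A`.
  refine ⟨e, fun g => ∑ w, J (D g w) * ρ (g * w) a, fun g h => ?_, fun g z => ?_⟩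
  · have h1 : ∑ w, J (D g w) * ρ (g * w) a =
        ∑ w, J (D g (h * w)) * ρ (g * (h * w)) a :=
      (Fintype.sum_equiv (Equiv.mulLeft (h : G ⧸ Z)) _ _ fun w => rfl).symm
    simp only [map_sum, map_mul (ρ _), hρJ, MonoidHom.comp_apply, QuotientGroup.mk'_apply]
    rw [h1, ← Finset.sum_add_distrib]
    refine Finset.sum_congr rfl fun w _ => ?_
    induction w using QuotientGroup.induction_on with | H w => ?_
    rw [← QuotientGroup.mk_mul, ← QuotientGroup.mk_mul, hD, hD, hD]
    rw [← AlgHom.mul_apply, ← map_mul, ← QuotientGroup.mk_mul, ← mul_assoc, ← add_mul,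
      ← map_add]
    congr 2
    ring
  · have h1 : ∑ w, J (e z) * ρ (g * w) a = J (e z) := by
      rw [← Finset.mul_sum, Fintype.sum_equiv (Equiv.mulLeft (g : G ⧸ Z))
        (fun w => ρ (g * w) a) (fun w => ρ w a) fun w => rfl, ha, mul_one]
    change _ = _ + J (e z)
    rw [← h1, ← Finset.sum_add_distrib]
    refine Finset.sum_congr rfl fun w _ => ?_
    induction w using QuotientGroup.induction_on with | H w => ?_
    rw [hD, hD, QuotientGroup.mk_mul_of_mem _ z.2, ← add_mul, ← map_add, hcomm, mul_assoc, hφ]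
    congr 2
    ring

/-- Over a single coset of `Z` the variable runs through all its prime-field translates, so the
power sum is `-1`. What remains is the trace of `a` over `G ⧸ Z`. -/
theorem exists_trace_one_translationAction (p : ℕ) [Fact p.Prime] [Fintype G] (j : ZMod p →+* k)
    (Z : Subgroup G) [Z.Normal] [Fintype (G ⧸ Z)] (ρ : G ⧸ Z →* (A →ₐ[k] A)) {a : A}
    (ha : ∑ w, ρ w a = 1) (e : Z ≃ ZMod p) (f : G → A)
    (hf : ∀ g h : G, f (g * h) = f g + ρ.comp (QuotientGroup.mk' Z) g (f h))
    (hfz : ∀ (g : G) (z : Z), f (g * z) = f g + algebraMap k A (j (e z))) :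
    ∑ g, translationAction (ρ.comp (QuotientGroup.mk' Z)) f hf g (-(X ^ (p - 1) * C a)) = 1 := by
  classical
  let J : ZMod p →+* A[X] := C.comp ((algebraMap k A).comp j)
  rw [sum_eq_sum_quotient Z]
  have key (w : G ⧸ Z) : ∑ z : Z, translationAction (ρ.comp (QuotientGroup.mk' Z)) f hf (w.out * z)
      (-(X ^ (p - 1) * C a)) = C (ρ w a) := by
    have h1 (z : Z) : translationAction (ρ.comp (QuotientGroup.mk' Z)) f hf (w.out * z)
      (-(X ^ (p - 1) * C a)) = (X + C (f w.out) + J (e z)) ^ (p - 1) * -C (ρ w a) := by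
      have : ((w.out * z : G) : G ⧸ Z) = w := by
        rw [QuotientGroup.mk_mul_of_mem _ z.2, QuotientGroup.out_eq']
      rw [map_neg, map_mul, map_pow, translationAction_X, translationAction_C, hfz,
        MonoidHom.comp_apply, QuotientGroup.mk'_apply, this]
      simp [J, add_assoc]
    simp_rw [h1]
    rw [← Finset.sum_mul, Fintype.sum_equiv e _ (fun x => (X + C (f w.out) + J x) ^ (p - 1))
      fun z => rfl, sum_add_zmod_pow]
    ring
  simp_rw [key]
  rw [← map_sum, ha, map_one]

end Extension

/-! ### A weakly initial domain -/

open Polynomial in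
/-- For a group of order `p ^ n` there is a weakly initial trace-one algebra which is a finitely
generated domain of dimension at most `n`. -/
theorem exists_weaklyInitial_domain (k : Type u) [Field k] (p : ℕ) [Fact p.Prime] [CharP k p]
    (n : ℕ) : ∀ (G : Type v) [Group G] [Fintype G], Nat.card G = p ^ n →
    ∃ (A : Type u) (_ : CommRing A) (_ : Algebra k A) (ρ : G →* (A →ₐ[k] A)),
      IsDomain A ∧ Algebra.FiniteType k A ∧ ringKrullDim A ≤ n ∧ (∃ a, ∑ g, ρ g a = 1) ∧
      ∀ (C : Type u) [CommRing C] [Algebra k C] (σ : G →* (C →ₐ[k] C)), (∃ c, ∑ g, σ g c = 1) →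
        ∃ f : A →ₐ[k] C, ∀ g a, f (ρ g a) = σ g (f a) := by
  induction n with
  | zero =>
    intro G _ _ hG
    have : Subsingleton G := (Nat.card_eq_one_iff_unique.1 (by simpa using hG)).1
    refine ⟨k, inferInstance, inferInstance, 1, inferInstance, inferInstance, ?_, ⟨1, ?_⟩, ?_⟩
    · simp
    · have hc : Fintype.card G = 1 := by simpa using hG
      simp [hc]
    · intro C _ _ σ _
      refine ⟨Algebra.ofId k C, fun g a => ?_⟩
      rw [Subsingleton.elim g 1, map_one, map_one]
      rfl
  | succ n ih =>
    intro G _ _ hG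
    classical
    obtain ⟨Z, hZ, hcard⟩ := exists_central_subgroup_card_prime p hG
    have hN : Z.Normal := ⟨fun z hz g => by
      rwa [Subgroup.mem_center_iff.1 (hZ hz) g, mul_inv_cancel_right]⟩
    have hq : Nat.card (G ⧸ Z) = p ^ n := by
      have := Subgroup.card_eq_card_quotient_mul_card_subgroup Z
      rw [hG, hcard, pow_succ] at this
      exact (Nat.eq_of_mul_eq_mul_right (Fact.out : p.Prime).pos this).symm
    obtain ⟨A, _, _, ρ, hdom, hfin, hdim, ⟨a, ha⟩, huniv⟩ := ih (G ⧸ Z) hq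
    let j : ZMod p →+* k := ZMod.castHom dvd_rfl k
    obtain ⟨e, f, hf, hfz⟩ := exists_crossedHom_extending p j Z hZ hcard ρ ha
    let ρ' := translationAction (ρ.comp (QuotientGroup.mk' Z)) f hf
    refine ⟨A[X], inferInstance, inferInstance, ρ', inferInstance, ?_, ?_,
      ⟨_, exists_trace_one_translationAction p j Z ρ ha e f hf hfz⟩, ?_⟩
    · exact Algebra.FiniteType.trans hfin inferInstance
    · have : IsNoetherianRing A := Algebra.FiniteType.isNoetherianRing k A
      rw [Polynomial.ringKrullDim_of_isNoetherianRing]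
      push_cast
      gcongr
    · rintro B _ _ σ ⟨c, hc⟩
      obtain ⟨ψ, hψ⟩ := huniv _ (quotientAction σ Z) (exists_trace_one_fixedSubalgebra σ Z ⟨c, hc⟩)
      let ψ' : A →ₐ[k] B := (fixedSubalgebra σ Z).val.comp ψ
      have hψ' (g : G) (x : A) : ψ' (ρ g x) = σ g (ψ' x) := by
        simp only [ψ', AlgHom.comp_apply, hψ]
        rfl
      -- An equivariant extension of `ψ'` must send `X` to an element that `g` translates by `ψ' (f
      -- g)`; vanishing cohomology supplies it.
      obtain ⟨t, ht⟩ := exists_principal_of_crossedHom σ hc (fun g => ψ' (f g)) fun g h => by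
        rw [hf, map_add, MonoidHom.comp_apply, QuotientGroup.mk'_apply, hψ']
      let F : A[X] →ₐ[k] B := eval₂AlgHom ψ' t fun _ => Commute.all _ _
      refine ⟨F, fun g => AlgHom.congr_fun (?_ : F.comp (ρ' g) = (σ g).comp F)⟩
      refine algHom_ext' ?_ ?_
      · ext x
        simp [F, ρ', hψ']
      · simp [F, ρ', ht]

/-! ### Krull dimension of finitely generated domains -/

section Dimension

/-- Contraction of primes is strictly monotone (incomparability); conversely, chains lift by lying
over and going up. -/
theorem ringKrullDim_eq_of_isIntegral {R S : Type*} [CommRing R] [CommRing S] [Algebra R S]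
    [Algebra.IsIntegral R S] [FaithfulSMul R S] : ringKrullDim S = ringKrullDim R := by
  refine le_antisymm ?_ (iSup_le fun l => ?_)
  · exact Order.krullDim_le_of_strictMono (PrimeSpectrum.comap (algebraMap R S)) fun P Q hPQ =>
      Ideal.IsIntegral.comap_lt_comap hPQ
  · obtain ⟨P, -, hP, hPl⟩ := Ideal.exists_ideal_over_prime_of_isIntegral (S := S)
      l.head.asIdeal ⊥ (by
        rw [← RingHom.ker_eq_comap_bot,
          (RingHom.injective_iff_ker_eq_bot _).1 (FaithfulSMul.algebraMap_injective R S)]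
        exact bot_le)
    have : P.LiesOver (RelSeries.head l).asIdeal := ⟨hPl.symm⟩
    obtain ⟨L, hL, -⟩ := Ideal.exists_ltSeries_of_hasGoingUp l P
    rw [← hL]
    exact Order.LTSeries.length_le_krullDim L

/-- By Noether normalization both invariants equal the number of variables. -/
theorem exists_ringKrullDim_eq_trdeg_eq (k A : Type*) [Field k] [CommRing A] [IsDomain A]
    [Algebra k A] [Algebra.FiniteType k A] :
    ∃ s : ℕ, ringKrullDim A = s ∧ Algebra.trdeg k A = s := by
  obtain ⟨s, g, hg, hint⟩ := exists_integral_inj_algHom_of_fg k A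
  algebraize [g.toRingHom]
  have : IsScalarTower k (MvPolynomial (Fin s) k) A :=
    IsScalarTower.of_algebraMap_eq fun x => (g.commutes x).symm
  have : FaithfulSMul (MvPolynomial (Fin s) k) A := (faithfulSMul_iff_algebraMap_injective _ _).2 hg
  have : Algebra.IsIntegral (MvPolynomial (Fin s) k) A := ⟨hint⟩
  refine ⟨s, ?_, ?_⟩
  · rw [ringKrullDim_eq_of_isIntegral (R := MvPolynomial (Fin s) k)]
    simp
  · have h := lift_trdeg_add_eq k (MvPolynomial (Fin s) k) A
    rw [trdeg_eq_zero (R := MvPolynomial (Fin s) k), MvPolynomial.trdeg_of_isDomain] at h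
    simpa [eq_comm] using h

theorem ringKrullDim_le_of_injective {k A B : Type*} [Field k] [CommRing A] [IsDomain A]
    [Algebra k A] [Algebra.FiniteType k A] [CommRing B] [IsDomain B] [Algebra k B]
    [Algebra.FiniteType k B] (f : A →ₐ[k] B) (hf : Function.Injective f) :
    ringKrullDim A ≤ ringKrullDim B := by
  obtain ⟨s, hs, hs'⟩ := exists_ringKrullDim_eq_trdeg_eq k A
  obtain ⟨t, ht, ht'⟩ := exists_ringKrullDim_eq_trdeg_eq k B
  have h := lift_trdeg_le_of_injective f hf
  rw [hs', ht'] at h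
  rw [hs, ht]
  simpa using h

/-- A nonzero kernel element is a nonzerodivisor, so it would lower the dimension by at least one;
finiteness of the dimension makes this a contradiction. -/
theorem injective_of_ringKrullDim_le {k A B : Type*} [Field k] [CommRing A] [IsDomain A]
    [Algebra k A] [Algebra.FiniteType k A] [CommRing B] [Algebra k B] (f : A →ₐ[k] B)
    (hf : Function.Surjective f) (h : ringKrullDim A ≤ ringKrullDim B) : Function.Injective f := by
  obtain ⟨s, hs, -⟩ := exists_ringKrullDim_eq_trdeg_eq k A
  rw [injective_iff_map_eq_zero]
  intro a ha
  by_contra h0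
  have h1 := (ringKrullDim_succ_le_of_surjective f.toRingHom hf
    (mem_nonZeroDivisors_of_ne_zero h0) ha).trans h
  have h2 : ringKrullDim B ≤ s := hs ▸ ringKrullDim_le_of_surjective f.toRingHom hf
  have h3 : (s : WithBot ℕ∞) ≤ ringKrullDim B := hs ▸ h
  rw [le_antisymm h2 h3, ← hs] at h1
  rw [hs] at h1
  have : ((s + 1 : ℕ) : WithBot ℕ∞) ≤ (s : ℕ) := by exact_mod_cast h1
  have : s + 1 ≤ s := by exact_mod_cast this
  omega

end Dimension

/-- The trace is linear over invariants, so an invariant `x` is the trace of `x * a`. -/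
theorem range_transferMap_eq_fixedPoints_iff {G : Type v} [Group G] [Fintype G] {A : Type u}
    [CommRing A] [MulSemiringAction G A] :
    Set.range (transferMap G A) = MulAction.fixedPoints G A ↔ ∃ a : A, ∑ g : G, g • a = 1 := by
  refine ⟨fun h => ?_, fun ⟨a, ha⟩ => Set.Subset.antisymm ?_ ?_⟩
  · have : (1 : A) ∈ Set.range (transferMap G A) := h ▸ fun g => smul_one g
    exact this
  · rintro _ ⟨x, rfl⟩ g
    simp only [transferMap, Finset.smul_sum]
    exact Fintype.sum_equiv (Equiv.mulLeft g) _ _ fun h => smul_smul g h x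
  · intro x hx
    refine ⟨x * a, ?_⟩
    have h (g : G) : g • (x * a) = x * g • a := by rw [smul_mul', hx g]
    simp only [transferMap, h]
    rw [← Finset.mul_sum, ha, mul_one]

/-! ### Images and monomorphisms in the category -/

namespace TsAlg

variable {k : Type u} [Field k] {G : Type v} [Group G] [Fintype G]

/-- The action of `G` on an object, as a homomorphism to the monoid of algebra endomorphisms. -/
def rep (A : TsAlg k G) : G →* (A →ₐ[k] A) where
  toFun g := MulSemiringAction.toAlgHom k A g
  map_one' := by ext; simp
  map_mul' g h := by ext; simp [mul_smul]

theorem exists_trace_one (A : TsAlg k G) : ∃ a, ∑ g, A.rep g a = 1 :=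
  range_transferMap_eq_fixedPoints_iff.1 A.traceSurjective

/-- The object defined by an action with an element of trace one. -/
def ofRep {X : Type u} [CommRing X] [Algebra k X] (ρ : G →* (X →ₐ[k] X))
    (hfin : Algebra.FiniteType k X) (h : ∃ a, ∑ g, ρ g a = 1) : TsAlg k G :=
  letI : MulSemiringAction G X :=
    { smul := fun g a => ρ g a
      one_smul := fun a => by change ρ 1 a = a; simp
      mul_smul := fun g h a => by change ρ (g * h) a = ρ g (ρ h a); simp
      smul_zero := fun g => map_zero (ρ g)
      smul_add := fun g => map_add (ρ g)
      smul_one := fun g => map_one (ρ g)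
      smul_mul := fun g => map_mul (ρ g) }
  haveI : SMulCommClass G k X := ⟨fun g c a => map_smul (ρ g) c a⟩
  { carrier := X
    finiteType := hfin
    traceSurjective := range_transferMap_eq_fixedPoints_iff.2 h }

/-- The object carried by a finitely generated stable subalgebra with an element of trace one. -/
def ofSubalgebra {X : Type u} [CommRing X] [Algebra k X] (ρ : G →* (X →ₐ[k] X))
    (S : Subalgebra k X) (hfin : S.FG) (hS : ∀ g, ∀ x ∈ S, ρ g x ∈ S)
    (h : ∃ a ∈ S, ∑ g, ρ g a = 1) : TsAlg k G :=
  ofRep (X := S)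
    { toFun g := ((ρ g).comp S.val).codRestrict S fun x => hS g x x.2
      map_one' := by ext; simp
      map_mul' g h := by ext; simp; rfl }
    (Subalgebra.fg_iff_finiteType S |>.1 hfin)
    (by
      obtain ⟨a, ha, h⟩ := h
      refine ⟨⟨a, ha⟩, Subtype.ext ?_⟩
      rw [AddSubmonoidClass.coe_finsetSum, OneMemClass.coe_one, ← h]
      rfl)

theorem fn_rep {A B : TsAlg k G} (f : A ⟶ B) (g : G) (a : A) :
    Hom.toAlgHom f (A.rep g a) = B.rep g (Hom.toAlgHom f a) := Hom.map_smul' f g a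

/-- Every morphism factors as a surjection followed by an inclusion. -/
theorem exists_image_factorization {A B : TsAlg k G} (f : A ⟶ B) :
    ∃ (Q : TsAlg k G) (π : A ⟶ Q) (ι : Q ⟶ B), Function.Surjective (Hom.fn π) ∧
      Function.Injective (Hom.fn ι) ∧ π ≫ ι = f := by
  let F : A →ₐ[k] B := Hom.toAlgHom f
  have := A.finiteType
  let Q : TsAlg k G := ofSubalgebra B.rep F.range
    ((Subalgebra.fg_iff_finiteType _).2 (Algebra.FiniteType.of_surjective F.rangeRestrict
      F.rangeRestrict_surjective))
    (by
      rintro g _ ⟨a, rfl⟩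
      exact ⟨A.rep g a, fn_rep f g a⟩)
    (by
      obtain ⟨a, ha⟩ := A.exists_trace_one
      refine ⟨F a, ⟨a, rfl⟩, ?_⟩
      rw [← map_one F, ← ha, map_sum]
      exact Finset.sum_congr rfl fun g _ => (fn_rep f g a).symm)
  let π : A ⟶ Q := ⟨F.rangeRestrict, fun g a => Subtype.ext (fn_rep f g a)⟩
  let ι : Q ⟶ B := ⟨F.range.val, fun _ _ => rfl⟩
  exact ⟨Q, π, ι, F.rangeRestrict_surjective, Subtype.val_injective, rfl⟩

theorem mono_of_injective {A B : TsAlg k G} (f : A ⟶ B) (hf : Function.Injective (Hom.fn f)) :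
    Mono f where
  right_cancellation {Z} _ _ hgh := Hom.ext <| AlgHom.ext fun z =>
    hf (congrArg (fun e : Z ⟶ B => Hom.fn e z) hgh)

/-- Monomorphisms are injective: test on the algebra generated by a trace-one element and one
element of the kernel pair. -/
theorem injective_of_mono {A B : TsAlg k G} (f : A ⟶ B) [Mono f] :
    Function.Injective (Hom.fn f) := by
  intro x y hxy
  obtain ⟨c, hc⟩ := A.exists_trace_one
  let ρ : G →* (A × A →ₐ[k] A × A) :=
    { toFun g := AlgHom.prodMap (A.rep g) (A.rep g)
      map_one' := by ext <;> simp <;> rfl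
      map_mul' _ _ := by ext <;> simp <;> rfl }
  have hρ (g : G) (z : A × A) : ρ g z = (A.rep g z.1, A.rep g z.2) := rfl
  let s : Set (A × A) := Set.range (fun g => ρ g (x, y)) ∪ Set.range (fun g => ρ g (c, c))
  have hs : s.Finite := (Set.finite_range _).union (Set.finite_range _)
  let S := Algebra.adjoin k s
  have hmem (z : A × A) (hz : ∀ g, ρ g z ∈ s) : z ∈ S := by
    have := Algebra.subset_adjoin (R := k) (hz 1)
    rwa [map_one] at this
  let T : TsAlg k G := ofSubalgebra ρ S ⟨hs.toFinset, by simp [S]⟩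
    (by
      intro g
      change S ≤ S.comap (ρ g)
      refine Algebra.adjoin_le ?_
      rintro _ (⟨h, rfl⟩ | ⟨h, rfl⟩) <;> refine Algebra.subset_adjoin ?_
      · exact .inl ⟨g * h, by simp⟩
      · exact .inr ⟨g * h, by simp⟩)
    ⟨(c, c), hmem _ fun g => .inr ⟨g, rfl⟩, by
      simp only [hρ]
      ext <;> simp [Prod.fst_sum, Prod.snd_sum, hc]⟩
  let p₁ : T ⟶ A := ⟨(AlgHom.fst k A A).comp S.val, fun g a => rfl⟩
  let p₂ : T ⟶ A := ⟨(AlgHom.snd k A A).comp S.val, fun g a => rfl⟩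
  have hS : S ≤ AlgHom.equalizer ((Hom.toAlgHom f).comp (AlgHom.fst k A A))
      ((Hom.toAlgHom f).comp (AlgHom.snd k A A)) := by
    refine Algebra.adjoin_le ?_
    rintro _ (⟨h, rfl⟩ | ⟨h, rfl⟩)
    · change Hom.toAlgHom f (A.rep h x) = Hom.toAlgHom f (A.rep h y)
      rw [fn_rep, fn_rep]
      exact congrArg _ hxy
    · rfl
  have hp : p₁ ≫ f = p₂ ≫ f := Hom.ext <| AlgHom.ext fun z => hS z.2
  have := (cancel_mono f).1 hp
  exact congrArg (fun e : T ⟶ A => Hom.fn e ⟨(x, y), hmem _ fun g => .inl ⟨g, rfl⟩⟩) this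

theorem prec_iff {A B : TsAlg k G} : A.Prec B ↔ ∃ f : A ⟶ B, Function.Injective (Hom.fn f) :=
  ⟨fun ⟨f, _⟩ => ⟨f, injective_of_mono f⟩, fun ⟨f, hf⟩ => ⟨f, mono_of_injective f hf⟩⟩

theorem Prec.trans {A B C : TsAlg k G} (h : A.Prec B) (h' : B.Prec C) : A.Prec C := by
  obtain ⟨f, _⟩ := h
  obtain ⟨g, _⟩ := h'
  exact ⟨f ≫ g, mono_comp f g⟩

theorem IsUniversal.of_hom {A B : TsAlg k G} (hB : B.IsUniversal) (f : A ⟶ B) : A.IsUniversal :=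
  fun C => (hB C).map fun g => f ≫ g

theorem Prec.isDomain {A B : TsAlg k G} (h : A.Prec B) [IsDomain B] : IsDomain A := by
  obtain ⟨f, hf⟩ := prec_iff.1 h
  exact Function.Injective.isDomain (Hom.toAlgHom f).toRingHom hf

theorem Prec.ringKrullDim_le {A B : TsAlg k G} (h : A.Prec B) [IsDomain B] :
    ringKrullDim A ≤ ringKrullDim B := by
  have := h.isDomain
  have := A.finiteType
  have := B.finiteType
  obtain ⟨f, hf⟩ := prec_iff.1 h
  exact ringKrullDim_le_of_injective (Hom.toAlgHom f) hf

variable (k G) in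
theorem exists_universal_domain (p n : ℕ) [Fact p.Prime] [CharP k p] (hG : Nat.card G = p ^ n) :
    ∃ A : TsAlg k G, A.IsUniversal ∧ IsDomain A ∧ ringKrullDim A ≤ n := by
  obtain ⟨X, _, _, ρ, hdom, hfin, hdim, htr, huniv⟩ := exists_weaklyInitial_domain k p n G hG
  refine ⟨ofRep ρ hfin htr, fun B => ?_, hdom, hdim⟩
  obtain ⟨f, hf⟩ := huniv B B.rep B.exists_trace_one
  exact ⟨⟨f, hf⟩⟩

/-! ### Universal and basic objects -/

/-- If all endomorphisms of a universal object are injective, it embeds in every universal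
object. -/
theorem IsUniversal.prec_of_endomorphisms_injective {A : TsAlg k G} (hA : A.IsUniversal)
    (h : ∀ α : A ⟶ A, Function.Injective (Hom.fn α)) (B : TsAlg k G) (hB : B.IsUniversal) :
    A.Prec B := by
  obtain ⟨f⟩ := hA B
  obtain ⟨g⟩ := hB A
  exact prec_iff.2 ⟨f, Function.Injective.of_comp (f := Hom.fn g) (h (f ≫ g))⟩

/-- The source of a monomorphism into `A` is itself universal, so minimality is a special case of
`h`. -/
theorem IsUniversal.isBasic_of_forall_prec {A : TsAlg k G} (hA : A.IsUniversal)
    (h : ∀ B : TsAlg k G, B.IsUniversal → A.Prec B) : A.IsBasic :=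
  ⟨hA, fun B ⟨f, _⟩ => h B (hA.of_hom f)⟩

theorem exists_ringKrullDim_eq (A : TsAlg k G) [IsDomain A] : ∃ d : ℕ, ringKrullDim A = d := by
  have := A.finiteType
  obtain ⟨d, hd, -⟩ := exists_ringKrullDim_eq_trdeg_eq k A
  exact ⟨d, hd⟩

/-- An endomorphism of a domain is injective as soon as its image has full dimension. -/
theorem injective_of_image_ringKrullDim {A : TsAlg k G} [IsDomain A] (α : A ⟶ A)
    (h : ∀ (Q : TsAlg k G) (_ : A ⟶ Q) (ι : Q ⟶ A), Function.Injective (Hom.fn ι) →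
      ringKrullDim A ≤ ringKrullDim Q) : Function.Injective (Hom.fn α) := by
  obtain ⟨Q, π, ι, hπ, hι, rfl⟩ := exists_image_factorization α
  have := A.finiteType
  exact hι.comp (injective_of_ringKrullDim_le (Hom.toAlgHom π) hπ (h Q π ι hι))

variable (k G) in
/-- A universal domain of least dimension has only injective endomorphisms. -/
theorem exists_universal_domain_endomorphisms_injective (p n : ℕ) [Fact p.Prime] [CharP k p]
    (hG : Nat.card G = p ^ n) :
    ∃ (A : TsAlg k G) (d : ℕ), A.IsUniversal ∧ IsDomain A ∧ ringKrullDim A = d ∧ d ≤ n ∧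
      ∀ α : A ⟶ A, Function.Injective (Hom.fn α) := by
  classical
  have hex : ∃ d : ℕ, ∃ A : TsAlg k G, A.IsUniversal ∧ IsDomain A ∧ ringKrullDim A = d ∧ d ≤ n := by
    obtain ⟨A, hA, hdom, hdim⟩ := exists_universal_domain k G p n hG
    obtain ⟨d, hd⟩ := A.exists_ringKrullDim_eq
    exact ⟨d, A, hA, hdom, hd, by rw [hd] at hdim; exact_mod_cast hdim⟩
  obtain ⟨A, hA, hdom, hd, hn⟩ := Nat.find_spec hex
  refine ⟨A, Nat.find hex, hA, hdom, hd, hn, fun α =>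
    injective_of_image_ringKrullDim α fun Q _ ι hι => ?_⟩
  have hQ : Q.Prec A := prec_iff.2 ⟨ι, hι⟩
  have := hQ.isDomain
  obtain ⟨e, he⟩ := Q.exists_ringKrullDim_eq
  rw [hd, he]
  -- The image `Q` is again a universal domain, so a smaller dimension would contradict the choice
  -- of `A`.
  by_contra hlt
  have hlt' : e < Nat.find hex := by exact_mod_cast not_le.1 hlt
  exact Nat.find_min hex hlt' ⟨Q, hA.of_hom ι, inferInstance, he, hlt'.le.trans hn⟩

variable (k G) in
/-- Some object admits a `k`-point: the algebra of functions on `G`. -/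
theorem exists_point : ∃ B : TsAlg k G, Nonempty (B →ₐ[k] k) := by
  classical
  let e := Fintype.equivFin G
  let ρ : G →* ((Fin (Fintype.card G) → k) →ₐ[k] (Fin (Fintype.card G) → k)) :=
    { toFun g := AlgHom.pi fun i => Pi.evalAlgHom k _ (e (e.symm i * g))
      map_one' := by ext; simp
      map_mul' g h := by ext; simp [mul_assoc] }
  refine ⟨ofRep ρ inferInstance ⟨Pi.single (e 1) 1, ?_⟩, ⟨Pi.evalAlgHom k _ (e 1)⟩⟩
  ext i
  have h (g : G) : ρ g (Pi.single (e 1) 1) i = if g = (e.symm i)⁻¹ then 1 else 0 := by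
    change Pi.single (M := fun _ => k) (e 1) 1 (e (e.symm i * g)) = _
    rw [Pi.single_apply]
    exact if_congr (by rw [e.injective.eq_iff, mul_eq_one_iff_inv_eq, eq_comm]) rfl rfl
  rw [Finset.sum_apply]
  simp [h]

/-- In dimension at most zero, the map to `k` through functions on `G` would be injective. Then `A`
is `k` with trivial action, where the trace is multiplication by the order of `G`, which is zero. -/
theorem IsUniversal.ringKrullDim_pos (p n : ℕ) [Fact p.Prime] [CharP k p]
    (hG : Nat.card G = p ^ n) [Nontrivial G] {A : TsAlg k G} [IsDomain A] (hA : A.IsUniversal) :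
    0 < ringKrullDim A := by
  by_contra hdim
  have := A.finiteType
  obtain ⟨B, ⟨χ⟩⟩ := exists_point k G
  obtain ⟨f⟩ := hA B
  let ψ : A →ₐ[k] k := χ.comp (Hom.toAlgHom f)
  have hψ : Function.Injective ψ := by
    refine injective_of_ringKrullDim_le ψ (fun c => ⟨algebraMap k A c, ψ.commutes c⟩) ?_
    rw [ringKrullDim_eq_zero_of_field]
    exact not_lt.1 hdim
  obtain ⟨a, ha⟩ := A.exists_trace_one
  have ha' : a = algebraMap k A (ψ a) := hψ (ψ.commutes _).symm
  have hn : n ≠ 0 := by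
    rintro rfl
    have := Finite.one_lt_card (α := G)
    rw [hG, pow_zero] at this
    exact this.false
  have hc : (Fintype.card G : A) = 0 := by
    rw [← Nat.card_eq_fintype_card, hG, ← map_natCast (algebraMap k A), Nat.cast_pow,
      CharP.cast_eq_zero, zero_pow hn, map_zero]
  have h (g : G) : A.rep g a = a := by
    rw [ha']
    exact (A.rep g).commutes _
  simp [h, hc] at ha

theorem IsBasic.prec_of_isUniversal_endomorphisms_injective {A B : TsAlg k G} (hA : A.IsBasic)
    (hB : B.IsUniversal) (h : ∀ α : B ⟶ B, Function.Injective (Hom.fn α)) : A.Prec B :=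
  hA.2 B (hB.prec_of_endomorphisms_injective h A hA.1)

/-- If a universal domain with injective endomorphisms exists, all endomorphisms of all basic
objects are injective. -/
theorem IsBasic.endomorphism_injective {A B : TsAlg k G} (hA : A.IsBasic)
    (hB : B.IsUniversal) [IsDomain B] (h : ∀ α : B ⟶ B, Function.Injective (Hom.fn α))
    (α : A ⟶ A) : Function.Injective (Hom.fn α) := by
  have hAB := hA.prec_of_isUniversal_endomorphisms_injective hB h
  have := hAB.isDomain
  refine injective_of_image_ringKrullDim α fun Q _ ι hι => ?_
  have : IsDomain Q := (prec_iff.2 ⟨ι, hι⟩ : Q.Prec A).isDomain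
  -- `Q` is universal, so `B` embeds in it and the dimension of `B` lies between those of `A` and
  -- `Q`.
  exact hAB.ringKrullDim_le.trans
    (hB.prec_of_endomorphisms_injective h Q (hA.1.of_hom ι)).ringKrullDim_le

/-- A proper quotient with a morphism to `A` yields a non-injective endomorphism. -/
theorem IsProperQuotient.exists_not_injective {Q A : TsAlg k G} (h : Q.IsProperQuotient A)
    (ι : Q ⟶ A) : ∃ α : A ⟶ A, ¬ Function.Injective (Hom.fn α) := by
  obtain ⟨π, -, hker⟩ := h
  refine ⟨π ≫ ι, fun hinj => hker ?_⟩
  exact (RingHom.injective_iff_ker_eq_bot _).1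
    (Function.Injective.of_comp (f := Hom.fn ι) (g := Hom.fn π) hinj)

/-- A non-injective endomorphism yields a proper quotient that is a subalgebra. -/
theorem exists_isProperQuotient {A : TsAlg k G} (α : A ⟶ A)
    (hα : ¬ Function.Injective (Hom.fn α)) :
    ∃ Q : TsAlg k G, Q.IsProperQuotient A ∧ Q.IsSubalgebraOf A := by
  obtain ⟨Q, π, ι, hπ, hι, rfl⟩ := exists_image_factorization α
  refine ⟨Q, ⟨π, hπ, fun hker => hα (hι.comp ?_)⟩, ι, hι⟩
  exact (RingHom.injective_iff_ker_eq_bot (Hom.toAlgHom π)).2 hker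

end TsAlg

theorem mainTheorem12 {k : Type u} [Field k] {G : Type v} [Group G] [Fintype G]
    (p n : ℕ) [Fact p.Prime] [CharP k p] (hG : Nat.card G = p ^ n) :
    (∀ A : TsAlg k G, A.IsUniversal →
      List.TFAE [
        A.IsBasic,
        A.IsBasic ∧ IsDomain A,
        ∀ α : A ⟶ A, Function.Injective (TsAlg.Hom.fn α),
        ∀ B : TsAlg k G, B.IsUniversal → A.Prec B,
        ∃ B : TsAlg k G, B.IsBasic ∧ A.Equivalent B,
        ∀ B : TsAlg k G, B.IsBasic → A.Equivalent B,
        ∀ Q : TsAlg k G, Q.IsProperQuotient A → ¬ Q.IsUniversal,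
        ∀ Q : TsAlg k G, Q.IsProperQuotient A → ¬ Q.IsSubalgebraOf A]) ∧
    (∃ A : TsAlg k G, A.IsBasic) ∧
    (∀ A : TsAlg k G, A.IsBasic → ∀ B : TsAlg k G, B.IsBasic ↔ A.Equivalent B) ∧
    (∃ d : ℕ, d ≤ n ∧ (Nontrivial G → 0 < d) ∧
      ∀ A : TsAlg k G, A.IsBasic → IsDomain A ∧ ringKrullDim A = d) := by
  obtain ⟨B₀, d, huniv, hdom, hd, hdn, hinj⟩ :=
    TsAlg.exists_universal_domain_endomorphisms_injective k G p n hG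
  have hbasic : B₀.IsBasic :=
    huniv.isBasic_of_forall_prec (huniv.prec_of_endomorphisms_injective hinj)
  have hprec {A : TsAlg k G} (hA : A.IsBasic) : ∀ B : TsAlg k G, B.IsUniversal → A.Prec B :=
    hA.1.prec_of_endomorphisms_injective (hA.endomorphism_injective huniv hinj)
  have hequiv {A B : TsAlg k G} (hA : A.IsBasic) (hB : B.IsBasic) : A.Equivalent B :=
    ⟨hprec hA B hB.1, hprec hB A hA.1⟩
  refine ⟨fun A hA => ?_, ⟨B₀, hbasic⟩, fun A hA B => ⟨hequiv hA, fun ⟨hAB, f, hf⟩ => ?_⟩,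
    d, hdn, fun _ => ?_, fun A hA => ?_⟩
  · tfae_have 1 → 3 := fun h => h.endomorphism_injective huniv hinj
    tfae_have 3 → 4 := hA.prec_of_endomorphisms_injective
    tfae_have 4 → 1 := hA.isBasic_of_forall_prec
    tfae_have 1 → 2 := fun h => ⟨h, (hprec h B₀ huniv).isDomain⟩
    tfae_have 2 → 1 := And.left
    tfae_have 1 → 6 := fun h B hB => hequiv h hB
    tfae_have 6 → 5 := fun h => ⟨B₀, hbasic, h B₀ hbasic⟩
    tfae_have 5 → 4 := fun ⟨B, hB, hAB⟩ C hC => hAB.1.trans (hprec hB C hC)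
    tfae_have 3 → 7 := fun h Q hQ hQu => by
      -- `ι` need not be injective: the quotient map already kills something, so the composite
      -- endomorphism does too.
      obtain ⟨ι⟩ := hQu A
      obtain ⟨α, hα⟩ := hQ.exists_not_injective ι
      exact hα (h α)
    tfae_have 7 → 8 := fun h Q hQ ⟨ι, _⟩ => h Q hQ (hA.of_hom ι)
    tfae_have 8 → 3 := fun h α => by
      by_contra hα
      obtain ⟨Q, hQ, hQA⟩ := TsAlg.exists_isProperQuotient α hα
      exact h Q hQ hQA
    tfae_finish
  · have hBA : B.Prec A := ⟨f, hf⟩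
    exact (hA.1.of_hom f).isBasic_of_forall_prec fun C hC => hBA.trans (hprec hA C hC)
  · have := huniv.ringKrullDim_pos p n hG
    rw [hd] at this
    exact_mod_cast this
  · have h := hequiv hA hbasic
    have hAdom : IsDomain A := h.1.isDomain
    exact ⟨hAdom, hd ▸ le_antisymm h.1.ringKrullDim_le h.2.ringKrullDim_le⟩
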